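/- Let $\mathcal V$ be a variety of algebras (finitary, one-sorted, given by operations and identities) that is commutative: for every algebra $A$ and every $n$-ary operation $\omega$, the map $\omega_A\colon A^n\to A$ is a homomorphism. Write $|\cdot|$ for underlying objects. For algebras $A,B$ let $[A,B]$ be the algebra of homomorphisms $A\to B$ with pointwise operations. A co-$\mathcal V$-algebra in $\mathcal V$ is an algebra $Y$ with homomorphisms $Y\to Y\sqcup\dots\sqcup Y$ ($n$ summands), one for each $n$-ary operation, satisfying the duals of the identities (a model of the theory in $\mathcal V^{\mathrm{op}}$). A morphism of co-$\mathcal V$-algebras is a homomorphism that commutes with the co-operations. Let $\mathcal V^c\mathcal V$ be the category of co-$\mathcal V$-algebras in $\mathcal V$. For $Y\in\mathcal V^c\mathcal V$ and an algebra $B$, the co-operations of $Y$ make $\mathrm{Hom}_{\mathcal V}(|Y|,B)$ an algebra, written $\mathrm{Hom}_{\mathcal V}(Y,B)$. The set of morphisms $Y\to Z$ in $\mathcal V^c\mathcal V$ is a subalgebra of $[|Y|,|Z|]$, written $[Y,Z]^c$. Let $F\colon\mathbf{Set}\to\mathcal V$ be the free functor and $\hat F\colon\mathbf{Set}\to\mathcal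 V^c\mathcal V$ its lift: $|\hat F(S)|=F(S)$, and the co-operation of $\omega$ sends a generator $s$ to $\omega(\iota_1s,\dots,\iota_ns)$, where $\iota_i$ is the $i$-th inclusion $F(S)\to F(S)\sqcup\dots\sqcup F(S)$. Thus $\mathrm{Hom}_{\mathcal V}(\hat F(S),B)\cong B^S$ as algebras. Let $\mathbb V(B)$ denote the algebra $B$ regarded as a $\mathcal V$-algebra object in $\mathcal V$ through its operations $B^n\to B$. It makes $\mathrm{Hom}_{\mathcal V}(A,\mathbb V(B))$ an algebra. There is a functor $C\colon\mathcal V\to\mathcal V^c\mathcal V$ with the following properties. 0. There is an isomorphism of algebras $\mathrm{Hom}_{\mathcal V}(C(A),B)\cong[A,B]$, natural in $A$ and $B$. 1. $C$ is a right inverse of the forgetful functor: $|C(-)|=\mathrm{id}_{\mathcal V}$. 2. $C$ is a left adjoint, and an enriched one: there are a functor $R\colon\mathcal V^c\mathcal V\to\mathcal V$ and an adjunction $C\dashv R$ whose natural bijection is an isomorphism of algebras $[C(A),Y]^c\cong[A,R(Y)]$, and $C$ and $R$ are homomorphisms on the algebras of morphisms. Moreover there is an isomorphism of algebras $\mathrm{Hom}_{\mathcal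 V}(C(A),B)\cong\mathrm{Hom}_{\mathcal V}(A,\mathbb V(B))$, natural in $A$ and $B$. 3. $\hat F=C\circ F$. 4. $C$ is strong monoidal from $(\mathcal V,\otimes,F(\{*\}))$ to $(\mathcal V^c\mathcal V,\odot,I)$. Here $\otimes$ is Linton's closed symmetric monoidal structure, in which homomorphisms $A\otimes B\to X$ correspond to functions $A\times B\to X$ that are homomorphisms in each variable. The structure $\odot$ is the Tall–Wraith monoidal structure, transported along the equivalence, given by $Y\mapsto\mathrm{Hom}_{\mathcal V}(Y,-)$, between $(\mathcal V^c\mathcal V)^{\mathrm{op}}$ and the category of representable functors $\mathcal V\to\mathcal V$ under composition: $\mathrm{Hom}_{\mathcal V}(Y\odot Z,B)\cong\mathrm{Hom}_{\mathcal V}(Y,\mathrm{Hom}_{\mathcal V}(Z,B))$, and $I$ represents the identity functor. -/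

import Mathlib

open CategoryTheory CategoryTheory.Limits Opposite

universe u v w

set_option linter.unusedVariables false

noncomputable section

namespace TallWraith

/-! ### Varieties of algebras -/

/-- Terms built from finitary operation symbols `Op n` (of arity `n`) and variables in `α`. -/
inductive Term (Op : ℕ → Type u) (α : Type v) : Type (max u v)
  | var : α → Term Op α
  | app : {n : ℕ} → Op n → (Fin n → Term Op α) → Term Op α

namespace Term

variable {Op : ℕ → Type u} {α : Type v}

/-- The value of a term in a set `M` on which the operation symbols act. -/
def eval {M : Type w} (op : ∀ {n : ℕ}, Op n → (Fin n → M) → M) (x : α → M) : Term Op α → M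
  | var a => x a
  | app ω s => op ω fun i => (s i).eval op x

end Term

/-- A finitary one-sorted algebraic theory, presented by operations and identities: operation
symbols of each finite arity, and for each `k` a set of identities `s = t` in `k` variables. -/
structure Variety where
  Op : ℕ → Type u
  Ax : ∀ k : ℕ, Term Op (Fin k) → Term Op (Fin k) → Prop

namespace Variety

/-- An algebra of the variety: a model of the theory in sets. -/
structure Alg (V : Variety.{u}) : Type (u + 1) where
  carrier : Type u
  op : ∀ {n : ℕ}, V.Op n → (Fin n → carrier) → carrier
  sat : ∀ {k : ℕ} {s t : Term V.Op (Fin k)}, V.Ax k s t →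
    ∀ x : Fin k → carrier, s.eval op x = t.eval op x

namespace Alg

variable {V : Variety.{u}}

instance : CoeSort V.Alg (Type u) := ⟨carrier⟩

/-- Homomorphisms of algebras. -/
@[ext]
structure Hom (A B : V.Alg) : Type u where
  toFun : A → B
  map_op : ∀ {n : ℕ} (ω : V.Op n) (x : Fin n → A),
    toFun (A.op ω x) = B.op ω fun i => toFun (x i)

instance : Category.{u} V.Alg where
  Hom A B := Hom A B
  id A := ⟨fun a => a, fun _ _ => rfl⟩
  comp f g := ⟨g.toFun ∘ f.toFun, fun ω x => by simp only [Function.comp, Hom.map_op]⟩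

instance {A B : V.Alg} : FunLike (A ⟶ B) A B where
  coe f := Hom.toFun f
  coe_injective f g h := Hom.ext h

@[simp] theorem id_apply (A : V.Alg) (a : A) : (𝟙 A : A ⟶ A) a = a := rfl

@[simp] theorem comp_apply {A B C : V.Alg} (f : A ⟶ B) (g : B ⟶ C) (a : A) :
    (f ≫ g) a = g (f a) := rfl

theorem map_op {A B : V.Alg} (f : A ⟶ B) {n : ℕ} (ω : V.Op n) (x : Fin n → A) :
    f (A.op ω x) = B.op ω fun i => f (x i) := Hom.map_op f ω x

theorem hom_ext {A B : V.Alg} {f g : A ⟶ B} (h : ∀ a, f a = g a) : f = g :=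
  DFunLike.ext _ _ h

/-- A homomorphism given by a function and a proof. -/
def mkHom {A B : V.Alg} (f : A → B)
    (h : ∀ {n : ℕ} (ω : V.Op n) (x : Fin n → A), f (A.op ω x) = B.op ω fun i => f (x i)) :
    A ⟶ B := Hom.mk f h

@[simp] theorem mkHom_apply {A B : V.Alg} (f : A → B)
    (h : ∀ {n : ℕ} (ω : V.Op n) (x : Fin n → A), f (A.op ω x) = B.op ω fun i => f (x i)) (a : A) :
    mkHom f h a = f a := rfl

theorem map_eval {A B : V.Alg} (f : A ⟶ B) {α : Type v} (x : α → A) (t : Term V.Op α) :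
    f (t.eval A.op x) = t.eval B.op fun a => f (x a) := by
  induction t with
  | var a => rfl
  | app ω s ih => simp only [Term.eval, map_op, ih]

/-- An invertible function compatible with the operations is an isomorphism. -/
def isoMk {A B : V.Alg} (e : A ≃ B)
    (h : ∀ {n : ℕ} (ω : V.Op n) (x : Fin n → A), e (A.op ω x) = B.op ω fun i => e (x i)) :
    A ≅ B where
  hom := mkHom e h
  inv := mkHom e.symm fun ω x => by
    apply e.injective
    simp [h]
  hom_inv_id := hom_ext fun a => by simp
  inv_hom_id := hom_ext fun a => by simp

end Alg

/-- The forgetful functor from the variety to sets. -/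
def forget (V : Variety.{u}) : V.Alg ⥤ Type u where
  obj A := A
  map f := TypeCat.ofHom f

/-! ### Algebras given by generators and relations -/

section Presentation

variable {V : Variety.{u}} {S : Type u}

/-- Equality of terms in the generators `S` forced by the identities of the variety and by the
relations `R`. -/
inductive Cong (V : Variety.{u}) {S : Type u} (R : Term V.Op S → Term V.Op S → Prop) :
    Term V.Op S → Term V.Op S → Prop
  | rel {s t : Term V.Op S} : R s t → Cong V R s t
  | ax {k : ℕ} {s t : Term V.Op (Fin k)} : V.Ax k s t → ∀ x : Fin k → Term V.Op S,
      Cong V R (s.eval Term.app x) (t.eval Term.app x)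
  | refl (s : Term V.Op S) : Cong V R s s
  | symm {s t : Term V.Op S} : Cong V R s t → Cong V R t s
  | trans {s t r : Term V.Op S} : Cong V R s t → Cong V R t r → Cong V R s r
  | app {n : ℕ} (ω : V.Op n) {s t : Fin n → Term V.Op S} :
      (∀ i, Cong V R (s i) (t i)) → Cong V R (Term.app ω s) (Term.app ω t)

/-- The setoid of `Cong`. -/
def congSetoid (V : Variety.{u}) {S : Type u} (R : Term V.Op S → Term V.Op S → Prop) :
    Setoid (Term V.Op S) :=
  ⟨Cong V R, ⟨Cong.refl, Cong.symm, Cong.trans⟩⟩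

variable (R : Term V.Op S → Term V.Op S → Prop)

/-- The operations on the quotient of the set of terms. -/
def presOp {n : ℕ} (ω : V.Op n) (x : Fin n → Quotient (congSetoid V R)) :
    Quotient (congSetoid V R) :=
  Quotient.mk _ (Term.app ω fun i => (x i).out)

theorem presOp_mk {n : ℕ} (ω : V.Op n) (s : Fin n → Term V.Op S) :
    presOp R ω (fun i => Quotient.mk _ (s i)) = Quotient.mk _ (Term.app ω s) :=
  Quotient.sound (Cong.app ω fun i =>
    (Quotient.mk_out (s := congSetoid V R) (s i) : Cong V R _ _))

theorem eval_presOp {α : Type v} (t : Term V.Op α) (x : α → Term V.Op S) :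
    t.eval (presOp R) (fun i => Quotient.mk _ (x i)) =
      Quotient.mk (congSetoid V R) (t.eval Term.app x) := by
  induction t with
  | var a => rfl
  | app ω s ih => simp only [Term.eval, ih, presOp_mk]

/-- The algebra with generators `S` and relations `R`. -/
def pres : V.Alg where
  carrier := Quotient (congSetoid V R)
  op := presOp R
  sat {k s t} h x := by
    have hx : x = fun i => Quotient.mk _ (x i).out := funext fun i => (Quotient.out_eq _).symm
    rw [hx, eval_presOp, eval_presOp]
    exact Quotient.sound (Cong.ax h _)

/-- The generators of `pres R`. -/
def pres.of (s : S) : pres R := Quotient.mk (congSetoid V R) (Term.var s)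

theorem pres.eval_of (t : Term V.Op S) :
    t.eval (pres R).op (pres.of R) = Quotient.mk (congSetoid V R) t := by
  have h := eval_presOp R t Term.var
  have h' : t.eval Term.app Term.var = t := by
    induction t with
    | var a => rfl
    | app ω s ih => simp only [Term.eval]; congr 1; funext i; exact ih i (eval_presOp R _ _)
  rw [h'] at h
  exact h

theorem pres.rel {s t : Term V.Op S} (h : R s t) :
    s.eval (pres R).op (pres.of R) = t.eval (pres R).op (pres.of R) := by
  rw [pres.eval_of, pres.eval_of]
  exact Quotient.sound (Cong.rel h)

theorem pres.exists_eval (z : pres R) : ∃ t : Term V.Op S, t.eval (pres R).op (pres.of R) = z :=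
  ⟨Quotient.out z, by rw [pres.eval_of]; exact Quotient.out_eq z⟩

theorem eval_app_eval {B : V.Alg} {α : Type v} (f : S → B) (t : Term V.Op α)
    (x : α → Term V.Op S) :
    (t.eval Term.app x).eval B.op f = t.eval B.op fun a => (x a).eval B.op f := by
  induction t with
  | var a => rfl
  | app ω s ih => simp only [Term.eval, ih]

theorem Cong.eval_eq {B : V.Alg} (f : S → B)
    (hf : ∀ s t, R s t → s.eval B.op f = t.eval B.op f) {s t : Term V.Op S} (h : Cong V R s t) :
    s.eval B.op f = t.eval B.op f := by
  induction h with
  | rel h => exact hf _ _ h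
  | ax h x => rw [eval_app_eval, eval_app_eval]; exact B.sat h _
  | refl s => rfl
  | symm _ ih => exact ih.symm
  | trans _ _ ih1 ih2 => exact ih1.trans ih2
  | app ω _ ih => simp only [Term.eval, ih]

/-- The homomorphism out of `pres R` determined by the images of the generators. -/
def pres.lift {B : V.Alg} (f : S → B) (hf : ∀ s t, R s t → s.eval B.op f = t.eval B.op f) :
    pres R ⟶ B :=
  Alg.mkHom (Quotient.lift (fun t => t.eval B.op f) fun _ _ h => Cong.eval_eq R f hf h)
    fun ω x => by
      have hx : x = fun i => Quotient.mk _ (x i).out := funext fun i => (Quotient.out_eq _).symm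
      rw [hx]
      exact congrArg _ (presOp_mk R ω _)

@[simp] theorem pres.lift_of {B : V.Alg} (f : S → B)
    (hf : ∀ s t, R s t → s.eval B.op f = t.eval B.op f) (s : S) :
    pres.lift R f hf (pres.of R s) = f s := rfl

theorem pres.hom_ext {B : V.Alg} {f g : pres R ⟶ B}
    (h : ∀ s, f (pres.of R s) = g (pres.of R s)) : f = g :=
  Alg.hom_ext fun z => by
    obtain ⟨t, rfl⟩ := pres.exists_eval R z
    simp only [Alg.map_eval, h]

end Presentation

/-! ### Free algebras -/

/-- The free algebra on a set. -/
def freeAlg (V : Variety.{u}) (S : Type u) : V.Alg := pres (V := V) (S := S) fun _ _ => False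

variable {V : Variety.{u}}

/-- The inclusion of the generators. -/
def freeAlg.of {S : Type u} (s : S) : V.freeAlg S := pres.of _ s

/-- The extension of a function to the free algebra. -/
def freeAlg.lift {S : Type u} {B : V.Alg} (f : S → B) : V.freeAlg S ⟶ B :=
  pres.lift _ f fun _ _ h => h.elim

@[simp] theorem freeAlg.lift_of {S : Type u} {B : V.Alg} (f : S → B) (s : S) :
    freeAlg.lift f (freeAlg.of s) = f s := rfl

theorem freeAlg.hom_ext {S : Type u} {B : V.Alg} {f g : V.freeAlg S ⟶ B}
    (h : ∀ s, f (freeAlg.of s) = g (freeAlg.of s)) : f = g :=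
  pres.hom_ext _ h

variable (V)

/-- The free functor from sets to the variety. -/
def free : Type u ⥤ V.Alg where
  obj S := V.freeAlg S
  map f := freeAlg.lift fun s => freeAlg.of (f s)
  map_id S := freeAlg.hom_ext fun s => by simp
  map_comp f g := freeAlg.hom_ext fun s => by simp

/-- The free functor is left adjoint to the forgetful functor. -/
def freeAdj : V.free ⊣ V.forget :=
  Adjunction.mkOfHomEquiv
    { homEquiv S B :=
        { toFun f := TypeCat.ofHom fun s => f (freeAlg.of s)
          invFun g := freeAlg.lift fun s => g s
          left_inv f := freeAlg.hom_ext fun s => rfl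
          right_inv g := rfl }
      homEquiv_naturality_left_symm f g := freeAlg.hom_ext fun s => rfl
      homEquiv_naturality_right f g := rfl }

/-! ### Finite products and coproducts of algebras -/

/-- The product of a family of algebras. -/
def piAlg {ι : Type} (A : ι → V.Alg) : V.Alg where
  carrier := ∀ i, A i
  op ω x := fun i => (A i).op ω fun j => x j i
  sat {k s t} h x := by
    have key : ∀ r : Term V.Op (Fin k),
        r.eval (M := ∀ i, A i) (fun ω x i => (A i).op ω fun j => x j i) x =
          fun i => r.eval (A i).op fun j => x j i := by
      intro r
      induction r with
      | var a => rfl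
      | app ω s ih => simp only [Term.eval, ih]
    rw [key, key]
    funext i
    exact (A i).sat h _

instance : HasFiniteProducts V.Alg where
  out n :=
    { has_limit := fun K =>
        haveI : HasLimit (Discrete.functor (K.obj ∘ Discrete.mk)) :=
          ⟨⟨⟨Fan.mk (V.piAlg fun i => K.obj ⟨i⟩) fun i => Alg.mkHom (fun x => x i) fun _ _ => rfl,
            Fan.IsLimit.mk _ (fun s => Alg.mkHom (fun a i => s.proj i a) fun ω x => by
                funext i; exact Alg.map_op (s.proj i) ω x)
              (fun s i => rfl)
              (fun s m hm => Alg.hom_ext fun a => funext fun i =>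
                congrArg (fun f : s.pt ⟶ K.obj ⟨i⟩ => f a) (hm i))⟩⟩⟩
        hasLimit_of_iso Discrete.natIsoFunctor.symm }

section Coproduct

variable {V} {ι : Type} (A : ι → V.Alg)

/-- The relations `ω (a₁, …, aₙ) = ω a` between elements of one summand. -/
inductive CoprodRel : Term V.Op (Σ i, A i) → Term V.Op (Σ i, A i) → Prop
  | mk (i : ι) {n : ℕ} (ω : V.Op n) (x : Fin n → A i) :
      CoprodRel (Term.app ω fun j => Term.var ⟨i, x j⟩) (Term.var ⟨i, (A i).op ω x⟩)

/-- The coproduct of a family of algebras. -/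
def coprodAlg : V.Alg := pres (CoprodRel A)

/-- The coproduct inclusions. -/
def coprodAlg.incl (i : ι) : A i ⟶ coprodAlg A :=
  Alg.mkHom (fun a => pres.of (CoprodRel A) ⟨i, a⟩) fun ω x =>
    (pres.rel (CoprodRel A) (CoprodRel.mk i ω x)).symm

/-- The coproduct cofan is a colimit. -/
def coprodAlg.isColimit : IsColimit (Cofan.mk (coprodAlg A) (coprodAlg.incl A)) :=
  Cofan.IsColimit.mk _
    (fun s => pres.lift (CoprodRel A) (fun p => s.inj p.1 p.2) (by
      rintro _ _ ⟨i, ω, x⟩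
      exact (Alg.map_op (s.inj i) ω x).symm))
    (fun s i => rfl)
    (fun s m hm => pres.hom_ext _ fun p =>
      congrArg (fun f : A p.1 ⟶ s.pt => f p.2) (hm p.1))

end Coproduct

instance : HasFiniteCoproducts V.Alg where
  out n :=
    { has_colimit := fun K =>
        haveI : HasColimit (Discrete.functor (K.obj ∘ Discrete.mk)) :=
          ⟨⟨⟨_, coprodAlg.isColimit fun i => K.obj ⟨i⟩⟩⟩⟩
        hasColimit_of_iso Discrete.natIsoFunctor }

/-- A coproduct is generated by the images of the summands. -/
theorem exists_eval_sigma {n : ℕ} (A : Fin n → V.Alg) (z : (∐ A : V.Alg)) :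
    ∃ t : Term V.Op (Σ i, A i), t.eval (∐ A : V.Alg).op (fun p => Sigma.ι A p.1 p.2) = z := by
  let e : coprodAlg A ⟶ ∐ A := (coprodAlg.isColimit A).desc (Cofan.mk _ (Sigma.ι A))
  let e' : ∐ A ⟶ coprodAlg A := Sigma.desc (coprodAlg.incl A)
  have he : e' ≫ e = 𝟙 _ := by
    apply Sigma.hom_ext
    intro i
    rw [Sigma.ι_desc_assoc, Category.comp_id]
    rfl
  obtain ⟨t, ht⟩ := pres.exists_eval (CoprodRel A) (e' z)
  refine ⟨t, ?_⟩
  have h1 : e (e' z) = z := by rw [← Alg.comp_apply, he, Alg.id_apply]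
  rw [← h1, ← ht]
  exact (Alg.map_eval e (pres.of (CoprodRel A)) t).symm

/-! ### Algebra objects and coalgebra objects in a category -/

section ModelObj

variable {D : Type w} [Category.{u} D] [HasFiniteProducts D]

/-- The morphism `X ^ k ⟶ X` that a term in `k` variables defines on an object `X` carrying
operations `X ^ n ⟶ X`. -/
def evalMor {V : Variety.{u}} {X : D}
    (op : ∀ {n : ℕ}, V.Op n → ((∏ᶜ fun _ : Fin n => X) ⟶ X)) {k : ℕ} :
    Term V.Op (Fin k) → ((∏ᶜ fun _ : Fin k => X) ⟶ X)
  | .var i => Pi.π (fun _ : Fin k => X) i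
  | .app ω s => Pi.lift (fun i => evalMor op (s i)) ≫ op ω

end ModelObj

/-- An algebra object of the variety in a category `D` with finite products: an object with
operations `X ^ n ⟶ X` satisfying the identities. -/
structure ModelObj (V : Variety.{u}) (D : Type w) [Category.{u} D] [HasFiniteProducts D] where
  X : D
  op : ∀ {n : ℕ}, V.Op n → ((∏ᶜ fun _ : Fin n => X) ⟶ X)
  sat : ∀ {k : ℕ} {s t : Term V.Op (Fin k)}, V.Ax k s t → evalMor op s = evalMor op t

namespace ModelObj

variable {V : Variety.{u}} {D : Type w} [Category.{u} D] [HasFiniteProducts D]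

/-- Morphisms of algebra objects. -/
@[ext]
structure Hom (M N : V.ModelObj D) : Type u where
  hom : M.X ⟶ N.X
  comm : ∀ {n : ℕ} (ω : V.Op n),
    M.op ω ≫ hom = Pi.lift (fun i => Pi.π (fun _ : Fin n => M.X) i ≫ hom) ≫ N.op ω

theorem lift_comp {X Y Z : D} {n : ℕ} (f : Fin n → (Z ⟶ X)) (g : X ⟶ Y) :
    Pi.lift f ≫ Pi.lift (fun i => Pi.π (fun _ : Fin n => X) i ≫ g) = Pi.lift fun i => f i ≫ g :=
  Pi.hom_ext _ _ fun i => by simp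

instance : Category.{u} (V.ModelObj D) where
  Hom M N := Hom M N
  id M := ⟨𝟙 M.X, fun {n} ω => by
    have : Pi.lift (fun i => Pi.π (fun _ : Fin n => M.X) i ≫ 𝟙 M.X) = 𝟙 _ :=
      Pi.hom_ext _ _ fun i => by simp
    rw [this, Category.comp_id, Category.id_comp]⟩
  comp f g := ⟨f.hom ≫ g.hom, fun ω => by
    rw [← Category.assoc, f.comm, Category.assoc, g.comm, ← Category.assoc, lift_comp]
    simp only [Category.assoc]⟩

variable (V D) in
/-- The underlying object of an algebra object. -/
def forget : V.ModelObj D ⥤ D where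
  obj M := M.X
  map f := Hom.hom f

theorem eval_hom (M : V.ModelObj D) (d : D) {k : ℕ} (t : Term V.Op (Fin k))
    (f : Fin k → (d ⟶ M.X)) :
    t.eval (M := d ⟶ M.X) (fun ω g => Pi.lift g ≫ M.op ω) f = Pi.lift f ≫ evalMor M.op t := by
  induction t with
  | var i => simp [Term.eval, evalMor]
  | app ω s ih =>
    simp only [Term.eval, evalMor, ih, ← Category.assoc]
    congr 1
    exact Pi.hom_ext _ _ fun i => by simp

/-- The algebra `Hom(d, M)` for an object `d` and an algebra object `M`; an operation sends
`f₁, …, fₙ` to the composite of `(f₁, …, fₙ) : d ⟶ M ^ n` with the operation of `M`. -/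
def homAlg (d : D) (M : V.ModelObj D) : V.Alg where
  carrier := d ⟶ M.X
  op ω f := Pi.lift f ≫ M.op ω
  sat h f := by rw [eval_hom, eval_hom, M.sat h]

theorem op_comp {M N : V.ModelObj D} {d : D} (g : M ⟶ N) {n : ℕ} (ω : V.Op n)
    (f : Fin n → (d ⟶ M.X)) :
    (Pi.lift f ≫ M.op ω) ≫ Hom.hom g = Pi.lift (fun i => f i ≫ Hom.hom g) ≫ N.op ω := by
  rw [Category.assoc, Hom.comm, ← Category.assoc, lift_comp]

theorem comp_op {M : V.ModelObj D} {d d' : D} (p : d' ⟶ d) {n : ℕ} (ω : V.Op n)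
    (f : Fin n → (d ⟶ M.X)) :
    p ≫ Pi.lift f ≫ M.op ω = Pi.lift (fun i => p ≫ f i) ≫ M.op ω := by
  rw [← Category.assoc]
  congr 1
  exact Pi.hom_ext _ _ fun i => by simp

variable (V D) in
/-- The functor `(d, M) ↦ Hom(d, M)` with values in algebras. -/
def homFunctor : Dᵒᵖ ⥤ V.ModelObj D ⥤ V.Alg where
  obj d :=
    { obj M := homAlg d.unop M
      map {M N} g := Alg.mkHom (fun f : d.unop ⟶ M.X => f ≫ Hom.hom g) fun ω f =>
        op_comp g ω f
      map_id M := Alg.hom_ext fun f => Category.comp_id (X := d.unop) (Y := M.X) f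
      map_comp g h := Alg.hom_ext fun f => (Category.assoc f (Hom.hom g) (Hom.hom h)).symm }
  map {d d'} p :=
    { app M := Alg.mkHom (fun f : d.unop ⟶ M.X => p.unop ≫ f) fun ω f =>
        comp_op p.unop ω f
      naturality M N g := Alg.hom_ext fun f => (Category.assoc p.unop f (Hom.hom g)).symm }
  map_id d := by
    ext M
    exact Alg.hom_ext fun f => Category.id_comp (X := d.unop) (Y := M.X) f
  map_comp p q := by
    ext M
    exact Alg.hom_ext fun f => Category.assoc q.unop p.unop f

end ModelObj

/-- The morphism `X ⟶ X ⊔ ⋯ ⊔ X` (`k` summands) that a term in `k` variables defines on an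
object `X` carrying co-operations. -/
def coevalMor {V : Variety.{u}} {D : Type w} [Category.{u} D] [HasFiniteCoproducts D] {X : D}
    (coop : ∀ {n : ℕ}, V.Op n → (X ⟶ ∐ fun _ : Fin n => X)) {k : ℕ} :
    Term V.Op (Fin k) → (X ⟶ ∐ fun _ : Fin k => X)
  | .var i => Limits.Sigma.ι (fun _ : Fin k => X) i
  | .app ω s => coop ω ≫ Limits.Sigma.desc fun i => coevalMor coop (s i)

/-- A co-algebra object of the variety in a category `D` with finite coproducts, that is, an
algebra object in the opposite category: an object with co-operations `X ⟶ X ⊔ ⋯ ⊔ X`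
satisfying the identities. -/
structure CoAlg (V : Variety.{u}) (D : Type w) [Category.{u} D] [HasFiniteCoproducts D] where
  X : D
  coop : ∀ {n : ℕ}, V.Op n → (X ⟶ ∐ fun _ : Fin n => X)
  sat : ∀ {k : ℕ} {s t : Term V.Op (Fin k)}, V.Ax k s t → coevalMor coop s = coevalMor coop t

namespace CoAlg

variable {V : Variety.{u}} {D : Type w} [Category.{u} D] [HasFiniteCoproducts D]

/-- Morphisms of co-algebra objects: morphisms in `D` that commute with the co-operations. -/
@[ext]
structure Hom (Y Z : V.CoAlg D) : Type u where
  hom : Y.X ⟶ Z.X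
  comm : ∀ {n : ℕ} (ω : V.Op n),
    hom ≫ Z.coop ω = Y.coop ω ≫ Limits.Sigma.desc fun i => hom ≫ Limits.Sigma.ι (fun _ : Fin n => Z.X) i

theorem desc_comp {X Y Z : D} {n : ℕ} (g : X ⟶ Y) (f : Fin n → (Y ⟶ Z)) :
    Limits.Sigma.desc (fun i => g ≫ Limits.Sigma.ι (fun _ : Fin n => Y) i) ≫ Limits.Sigma.desc f =
      Limits.Sigma.desc fun i => g ≫ f i :=
  Limits.Sigma.hom_ext _ _ fun i => by simp

instance : Category.{u} (V.CoAlg D) where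
  Hom Y Z := Hom Y Z
  id Y := ⟨𝟙 Y.X, fun {n} ω => by
    have : Limits.Sigma.desc (fun i => 𝟙 Y.X ≫ Limits.Sigma.ι (fun _ : Fin n => Y.X) i) = 𝟙 _ :=
      Limits.Sigma.hom_ext _ _ fun i => by simp
    rw [this, Category.comp_id, Category.id_comp]⟩
  comp f g := ⟨f.hom ≫ g.hom, fun ω => by
    rw [Category.assoc, g.comm, ← Category.assoc, f.comm, Category.assoc, desc_comp]
    simp only [Category.assoc]⟩

theorem hom_ext {Y Z : V.CoAlg D} {f g : Y ⟶ Z} (h : Hom.hom f = Hom.hom g) : f = g :=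
  Hom.ext h

variable (V D) in
/-- The forgetful functor from co-algebra objects to `D`. -/
def forget : V.CoAlg D ⥤ D where
  obj Y := Y.X
  map f := Hom.hom f

theorem eval_hom (Y : V.CoAlg D) (d : D) {k : ℕ} (t : Term V.Op (Fin k))
    (f : Fin k → (Y.X ⟶ d)) :
    t.eval (M := Y.X ⟶ d) (fun ω g => Y.coop ω ≫ Limits.Sigma.desc g) f =
      coevalMor Y.coop t ≫ Limits.Sigma.desc f := by
  induction t with
  | var i => simp [Term.eval, coevalMor]
  | app ω s ih =>
    simp only [Term.eval, coevalMor, ih, Category.assoc]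
    congr 1
    exact Limits.Sigma.hom_ext _ _ fun i => by simp

/-- The algebra `Hom(Y, d)` for a co-algebra object `Y` and an object `d`; an operation sends
`f₁, …, fₙ` to the composite of the co-operation `Y ⟶ Y ⊔ ⋯ ⊔ Y` with the morphism
`Y ⊔ ⋯ ⊔ Y ⟶ d` with components `f₁, …, fₙ`. -/
def homAlg (Y : V.CoAlg D) (d : D) : V.Alg where
  carrier := Y.X ⟶ d
  op ω f := Y.coop ω ≫ Limits.Sigma.desc f
  sat h f := by rw [eval_hom, eval_hom, Y.sat h]

theorem coop_comp {Y : V.CoAlg D} {d d' : D} (g : d ⟶ d') {n : ℕ} (ω : V.Op n)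
    (f : Fin n → (Y.X ⟶ d)) :
    (Y.coop ω ≫ Limits.Sigma.desc f) ≫ g = Y.coop ω ≫ Limits.Sigma.desc fun i => f i ≫ g := by
  rw [Category.assoc]
  congr 1
  exact Limits.Sigma.hom_ext _ _ fun i => by simp

theorem comp_coop {Y Z : V.CoAlg D} {d : D} (p : Z ⟶ Y) {n : ℕ} (ω : V.Op n)
    (f : Fin n → (Y.X ⟶ d)) :
    Hom.hom p ≫ Y.coop ω ≫ Limits.Sigma.desc f =
      Z.coop ω ≫ Limits.Sigma.desc fun i => Hom.hom p ≫ f i := by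
  rw [← Category.assoc, Hom.comm, Category.assoc, desc_comp]

/-- The functor `d ↦ Hom(Y, d)` represented by a co-algebra object. -/
def homFrom (Y : V.CoAlg D) : D ⥤ V.Alg where
  obj d := homAlg Y d
  map {d d'} g := Alg.mkHom (fun f : Y.X ⟶ d => f ≫ g) fun ω f => coop_comp g ω f
  map_id d := Alg.hom_ext fun f => Category.comp_id (X := Y.X) (Y := d) f
  map_comp g h := Alg.hom_ext fun f => (Category.assoc (W := Y.X) f g h).symm

variable (V D) in
/-- The functor `(Y, d) ↦ Hom(Y, d)` with values in algebras. -/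
def homFunctor : (V.CoAlg D)ᵒᵖ ⥤ D ⥤ V.Alg where
  obj Y := homFrom Y.unop
  map {Y Z} p :=
    { app d := Alg.mkHom (fun f : Y.unop.X ⟶ d => Hom.hom p.unop ≫ f) fun ω f =>
        comp_coop p.unop ω f
      naturality d d' g := Alg.hom_ext fun f =>
        (Category.assoc (X := Y.unop.X) (Hom.hom p.unop) f g).symm }
  map_id Y := by
    ext d
    exact Alg.hom_ext fun f => Category.id_comp (X := Y.unop.X) (Y := d) f
  map_comp {Y Z T} p q := by
    ext d
    exact Alg.hom_ext fun f =>
      Category.assoc (W := T.unop.X) (X := Z.unop.X) (Y := Y.unop.X) (Z := d) _ _ f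

end CoAlg

/-! ### The lift of the free functor to co-algebras -/

section FreeHat

variable (V : Variety.{u})

/-- The co-operation on the free algebra on `S`: a generator `s` is sent to
`ω (ι₁ s, …, ιₙ s)`. -/
def freeCoop (S : Type u) {n : ℕ} (ω : V.Op n) :
    V.freeAlg S ⟶ ∐ fun _ : Fin n => V.freeAlg S :=
  freeAlg.lift fun s => (∐ fun _ : Fin n => V.freeAlg S : V.Alg).op ω fun i =>
    Limits.Sigma.ι (fun _ : Fin n => V.freeAlg S) i (freeAlg.of s)

theorem freeCoop_desc (S : Type u) {n : ℕ} (ω : V.Op n) {B : V.Alg}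
    (f : Fin n → (V.freeAlg S ⟶ B)) (s : S) :
    (V.freeCoop S ω ≫ Limits.Sigma.desc f) (freeAlg.of s) = B.op ω fun i => f i (freeAlg.of s) := by
  change Limits.Sigma.desc f (V.freeCoop S ω (freeAlg.of s)) = _
  rw [freeCoop, freeAlg.lift_of, Alg.map_op]
  congr 1
  funext i
  rw [← Alg.comp_apply, Limits.Sigma.ι_desc]

/-- The free algebra on `S` as a co-algebra, so that `Hom(F S, A)` is the power `A ^ S`. -/
def freeCoAlg (S : Type u) : V.CoAlg V.Alg where
  X := V.freeAlg S
  coop ω := V.freeCoop S ω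
  sat {k s t} h := by
    have key : ∀ r : Term V.Op (Fin k), ∀ a : S,
        coevalMor (V := V) (fun ω => V.freeCoop S ω) r (freeAlg.of a) =
          r.eval (∐ fun _ : Fin k => V.freeAlg S : V.Alg).op fun i =>
            Limits.Sigma.ι (fun _ : Fin k => V.freeAlg S) i (freeAlg.of a) := by
      intro r a
      induction r with
      | var i => rfl
      | app ω s ih => simp only [coevalMor, Term.eval, freeCoop_desc, ih]
    exact freeAlg.hom_ext fun a => by
      rw [key, key]
      exact (∐ fun _ : Fin k => V.freeAlg S : V.Alg).sat h _

/-- The lift of the free functor to co-algebras. -/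
def freeHat : Type u ⥤ V.CoAlg V.Alg where
  obj S := V.freeCoAlg S
  map {S T} f := CoAlg.Hom.mk (V.free.map f) fun {n} ω => freeAlg.hom_ext fun s => by
    exact (V.freeCoop_desc S ω
      (fun i => V.free.map f ≫ Limits.Sigma.ι (fun _ : Fin n => V.freeAlg T) i) s).symm
  map_id S := CoAlg.hom_ext (V.free.map_id S)
  map_comp f g := CoAlg.hom_ext (V.free.map_comp f g)

end FreeHat

/-! ### The Tall–Wraith monoidal structure -/

section TallWraithStructure

/-- The category of endofunctors, with composition `F ∘ G` as tensor product `F ⊗ G`. -/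
@[reducible]
def compositionMonoidal (E : Type w) [Category.{v} E] : MonoidalCategory (E ⥤ E) where
  tensorObj F G := G ⋙ F
  whiskerLeft F _ _ α := Functor.whiskerRight α F
  whiskerRight α G := Functor.whiskerLeft G α
  tensorHom α β := β ◫ α
  tensorUnit := 𝟭 E
  associator F G H := (Functor.associator H G F).symm
  leftUnitor F := Functor.rightUnitor F
  rightUnitor F := Functor.leftUnitor F

attribute [local instance] compositionMonoidal

variable (V : Variety.{u})

/-- An endofunctor of the variety is representable if its underlying set-valued functor is. -/
def representable : ObjectProperty (V.Alg ⥤ V.Alg) :=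
  fun G => (G ⋙ V.forget).IsCorepresentable

/-- The category of representable endofunctors of the variety. -/
abbrev CovRep : Type (u + 1) := V.representable.FullSubcategory

variable {V}

theorem representable_homFrom (Y : V.CoAlg V.Alg) : V.representable (CoAlg.homFrom Y) :=
  ⟨Y.X, ⟨{ homEquiv := Equiv.refl _, homEquiv_comp := fun _ _ => rfl }⟩⟩

variable (V) in
/-- The functor that sends a co-algebra to the functor it represents. -/
def toCovRep : V.CoAlg V.Alg ⥤ V.CovRepᵒᵖ where
  obj Y := op ⟨CoAlg.homFrom Y, representable_homFrom Y⟩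
  map f := (ObjectProperty.homMk ((CoAlg.homFunctor V V.Alg).map f.op)).op
  map_id Y := by
    apply Quiver.Hom.unop_inj
    apply ObjectProperty.hom_ext
    exact (CoAlg.homFunctor V V.Alg).map_id (op Y)
  map_comp f g := by
    apply Quiver.Hom.unop_inj
    apply ObjectProperty.hom_ext
    exact (CoAlg.homFunctor V V.Alg).map_comp g.op f.op


instance : (toCovRep V).Faithful where
  map_injective {Y Z f g} h := CoAlg.hom_ext <| by
    have h1 := congrArg (fun φ : (toCovRep V).obj Y ⟶ (toCovRep V).obj Z => φ.unop.hom.app Z.X) h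
    have h2 := congrArg (fun φ : CoAlg.homAlg Z Z.X ⟶ CoAlg.homAlg Y Z.X => φ (𝟙 Z.X)) h1
    have key : ∀ k : Y ⟶ Z, CoAlg.Hom.hom k ≫ 𝟙 Z.X = CoAlg.Hom.hom k :=
      fun k => Category.comp_id _
    exact (key f).symm.trans (Eq.trans h2 (key g))

theorem natTrans_app {Y Z : V.CoAlg V.Alg} (α : CoAlg.homFrom Z ⟶ CoAlg.homFrom Y) {B : V.Alg}
    (g : Z.X ⟶ B) : (α.app B g : Y.X ⟶ B) = (α.app Z.X (𝟙 Z.X) : Y.X ⟶ Z.X) ≫ g := by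
  have h := congrArg (fun φ : CoAlg.homAlg Z Z.X ⟶ CoAlg.homAlg Y B => φ (𝟙 Z.X))
    (α.naturality g)
  have h' : (α.app B (𝟙 Z.X ≫ g : Z.X ⟶ B) : Y.X ⟶ B) =
      (α.app Z.X (𝟙 Z.X) : Y.X ⟶ Z.X) ≫ g := h
  rwa [Category.id_comp] at h'

instance : (toCovRep V).Full where
  map_surjective {Y Z} φ := by
    let α : CoAlg.homFrom Z ⟶ CoAlg.homFrom Y := φ.unop.hom
    let f : Y.X ⟶ Z.X := α.app Z.X (𝟙 Z.X)
    have hf : ∀ {B : V.Alg} (g : Z.X ⟶ B), (α.app B g : Y.X ⟶ B) = f ≫ g := natTrans_app α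
    refine ⟨CoAlg.Hom.mk f fun {n} ω => ?_, ?_⟩
    · have h := Alg.map_op (α.app (∐ fun _ : Fin n => Z.X)) ω
        (fun i => Limits.Sigma.ι (fun _ : Fin n => Z.X) i)
      have h1 : (α.app (∐ fun _ : Fin n => Z.X) (Z.coop ω ≫ Limits.Sigma.desc fun i =>
          Limits.Sigma.ι (fun _ : Fin n => Z.X) i) : Y.X ⟶ _) =
          Y.coop ω ≫ Limits.Sigma.desc fun i =>
            (α.app (∐ fun _ : Fin n => Z.X) (Limits.Sigma.ι (fun _ : Fin n => Z.X) i) :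
              Y.X ⟶ _) := h
      have h2 : (Limits.Sigma.desc fun i => Limits.Sigma.ι (fun _ : Fin n => Z.X) i) = 𝟙 _ :=
        Limits.Sigma.hom_ext _ _ fun i => by simp
      rw [hf, h2, Category.comp_id] at h1
      rw [h1]
      congr 2
      funext i
      exact hf _
    · apply Quiver.Hom.unop_inj
      apply ObjectProperty.hom_ext
      ext B
      exact Alg.hom_ext fun g => (hf (B := B) g).symm

section Lift

variable (G : V.Alg ⥤ V.Alg) {A : V.Alg} (e : (G ⋙ V.forget).CorepresentableBy A)

/-- The bijection `Hom(A, B) ≃ G B` of a representation. -/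
def repEquiv (B : V.Alg) : (A ⟶ B) ≃ G.obj B := e.homEquiv

theorem repEquiv_comp {B B' : V.Alg} (f : A ⟶ B) (g : B ⟶ B') :
    repEquiv G e B' (f ≫ g) = G.map g (repEquiv G e B f) := e.homEquiv_comp g f

/-- The co-operations on an object representing the underlying functor of `G`. -/
def repCoop {n : ℕ} (ω : V.Op n) : A ⟶ ∐ fun _ : Fin n => A :=
  (repEquiv G e _).symm ((G.obj (∐ fun _ : Fin n => A)).op ω fun i =>
    repEquiv G e _ (Limits.Sigma.ι (fun _ : Fin n => A) i))

theorem repEquiv_repCoop {n : ℕ} (ω : V.Op n) {B : V.Alg} (f : Fin n → (A ⟶ B)) :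
    repEquiv G e B (repCoop G e ω ≫ Limits.Sigma.desc f) =
      (G.obj B).op ω fun i => repEquiv G e B (f i) := by
  rw [repEquiv_comp, repCoop, Equiv.apply_symm_apply, Alg.map_op]
  congr 1
  funext i
  rw [← repEquiv_comp, Limits.Sigma.ι_desc]

/-- An object representing the underlying functor of `G` as a co-algebra. -/
def repCoAlg : V.CoAlg V.Alg where
  X := A
  coop ω := repCoop G e ω
  sat {k s t} h := by
    have key : ∀ r : Term V.Op (Fin k),
        repEquiv G e _ (coevalMor (V := V) (fun ω => repCoop G e ω) r) =
          r.eval (G.obj (∐ fun _ : Fin k => A)).op fun i =>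
            repEquiv G e _ (Limits.Sigma.ι (fun _ : Fin k => A) i) := by
      intro r
      induction r with
      | var i => rfl
      | app ω s ih => simp only [coevalMor, Term.eval, repEquiv_repCoop, ih]
    apply (repEquiv G e _).injective
    rw [key, key]
    exact (G.obj (∐ fun _ : Fin k => A)).sat h _

/-- A representable functor is isomorphic to the one represented by the co-algebra. -/
def repIso : CoAlg.homFrom (repCoAlg G e) ≅ G :=
  NatIso.ofComponents
    (fun B => Alg.isoMk (repEquiv G e B) fun ω f => repEquiv_repCoop G e ω f)
    (fun {B B'} g => Alg.hom_ext fun f => repEquiv_comp G e f g)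

end Lift

instance : (toCovRep V).EssSurj where
  mem_essImage P := by
    obtain ⟨A, ⟨e⟩⟩ := P.unop.property
    exact ⟨repCoAlg _ e, ⟨(V.representable.isoMk (repIso _ e).symm).op⟩⟩

instance : (toCovRep V).IsEquivalence where

/-! Representable functors are closed under composition. -/

section Composition

variable (A : V.Alg) (Y : V.CoAlg V.Alg)

/-- Relations on `A × Y` that make a function on it a homomorphism from `A` to `Hom(Y, -)`. -/
inductive TWRel : Term V.Op (A × Y.X) → Term V.Op (A × Y.X) → Prop
  | right (a : A) {n : ℕ} (ω : V.Op n) (y : Fin n → Y.X) :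
      TWRel (Term.app ω fun i => Term.var (a, y i)) (Term.var (a, Y.X.op ω y))
  | left {n : ℕ} (ω : V.Op n) (a : Fin n → A) (y : Y.X) (t : Term V.Op (Σ _ : Fin n, Y.X))
      (ht : t.eval (∐ fun _ : Fin n => Y.X : V.Alg).op
        (fun p => Limits.Sigma.ι (fun _ : Fin n => Y.X) p.1 p.2) = Y.coop ω y) :
      TWRel (t.eval Term.app fun p => Term.var (a p.1, p.2)) (Term.var (A.op ω a, y))

theorem coop_desc_apply {B : V.Alg} {n : ℕ} (ω : V.Op n) (f : Fin n → (Y.X ⟶ B)) (y : Y.X)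
    (t : Term V.Op (Σ _ : Fin n, Y.X))
    (ht : t.eval (∐ fun _ : Fin n => Y.X : V.Alg).op
        (fun p => Limits.Sigma.ι (fun _ : Fin n => Y.X) p.1 p.2) = Y.coop ω y) :
    (Y.coop ω ≫ Limits.Sigma.desc f) y = t.eval B.op fun p => f p.1 p.2 := by
  rw [Alg.comp_apply, ← ht, Alg.map_eval]
  congr 1
  funext p
  rw [← Alg.comp_apply, Limits.Sigma.ι_desc]

/-- Homomorphisms out of `pres (TWRel A Y)` are homomorphisms from `A` to `Hom(Y, -)`. -/
def twEquiv (B : V.Alg) : (pres (TWRel A Y) ⟶ B) ≃ (A ⟶ (CoAlg.homFrom Y).obj B) where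
  toFun h := Alg.mkHom
    (fun a => (Alg.mkHom (fun y => h (pres.of _ (a, y))) fun ω y => by
      rw [← Alg.map_op]
      exact congrArg h (pres.rel _ (TWRel.right a ω y)).symm : Y.X ⟶ B))
    fun ω a => Alg.hom_ext fun y => by
      obtain ⟨t, ht⟩ := exists_eval_sigma V _ (Y.coop ω y)
      have h1 := pres.rel _ (TWRel.left ω a y t ht)
      rw [eval_app_eval] at h1
      refine (congrArg h h1.symm).trans ?_
      rw [Alg.map_eval]
      exact (coop_desc_apply Y ω (fun i => (Alg.mkHom (fun y => h (pres.of _ (a i, y))) fun ω y => by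
        rw [← Alg.map_op]
        exact congrArg h (pres.rel _ (TWRel.right (a i) ω y)).symm : Y.X ⟶ B)) y t ht).symm
  invFun φ := pres.lift _ (fun p => (show Y.X ⟶ B from φ p.1) p.2) (by
    rintro _ _ (⟨a, ω, y⟩ | ⟨ω, a, y, t, ht⟩)
    · exact (Alg.map_op (φ a : Y.X ⟶ B) ω y).symm
    · rw [eval_app_eval]
      have h := congrArg (fun f : Y.X ⟶ B => f y) (Alg.map_op φ ω a)
      exact ((coop_desc_apply Y ω (fun i => (φ (a i) : Y.X ⟶ B)) y t ht).symm.trans h.symm))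
  left_inv h := pres.hom_ext _ fun p => rfl
  right_inv φ := Alg.hom_ext fun a => Alg.hom_ext fun y => rfl

theorem representable_comp {F G : V.Alg ⥤ V.Alg} (hF : V.representable F)
    (hG : V.representable G) : V.representable (G ⋙ F) := by
  obtain ⟨A, ⟨e⟩⟩ := hF
  obtain ⟨Z, ⟨d⟩⟩ := hG
  let i := repIso G d
  refine ⟨pres (TWRel A (repCoAlg G d)), ⟨⟨fun {B} => (twEquiv A (repCoAlg G d) B).trans
    (Equiv.trans ((i.app B).homToEquiv (Z := A)) (repEquiv F e (G.obj B))), fun {B B'} g h => ?_⟩⟩⟩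
  change repEquiv F e _ ((twEquiv A _ B' (h ≫ g)) ≫ i.hom.app B') =
    F.map (G.map g) (repEquiv F e _ ((twEquiv A _ B h) ≫ i.hom.app B))
  rw [← repEquiv_comp, Category.assoc, ← i.hom.naturality, ← Category.assoc]
  rfl

end Composition

instance : V.representable.IsMonoidal where
  prop_unit := ⟨V.freeAlg PUnit, ⟨⟨⟨fun f => f (freeAlg.of PUnit.unit),
    fun b => freeAlg.lift fun _ => b, fun f => freeAlg.hom_ext fun _ => rfl, fun b => rfl⟩,
    fun g f => rfl⟩⟩⟩
  prop_tensor _ _ h₁ h₂ := representable_comp h₁ h₂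

/-- The Tall–Wraith monoidal structure on co-algebras: the structure for which the equivalence
with the opposite of the category of representable endofunctors is monoidal. Thus `Y ⊗ Z`
represents the functor `B ↦ Hom(Y, Hom(Z, B))`, and the unit represents the identity functor. -/
instance : MonoidalCategory (V.CoAlg V.Alg) :=
  Monoidal.transport (toCovRep V).asEquivalence.symm

end TallWraithStructure

/-! ### Commutative varieties -/

/-- A variety is commutative if every operation lifts to a morphism of the variety, that is, if
for every algebra `A` and every `n`-ary operation the function `A ^ n → A` is a homomorphism.
(It follows that all operations composed of those in `V.Op` lift too.) -/
class IsCommutative (V : Variety.{u}) : Prop where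
  lifts : ∀ (A : V.Alg) {n : ℕ} (ω : V.Op n),
    ∃ f : V.piAlg (fun _ : Fin n => A) ⟶ A, ∀ x : Fin n → A, f x = A.op ω x

section Commutative

variable (V : Variety.{u}) [V.IsCommutative]

variable {V} in
theorem op_op (A : V.Alg) {m n : ℕ} (σ : V.Op m) (τ : V.Op n) (x : Fin m → Fin n → A) :
    A.op σ (fun i => A.op τ (x i)) = A.op τ fun j => A.op σ fun i => x i j := by
  obtain ⟨f, hf⟩ := IsCommutative.lifts A τ
  exact (congrArg (A.op σ) (funext fun i => (hf (x i)).symm)).trans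
    ((Alg.map_op f σ x).symm.trans (hf _))

/-! #### The enriched hom -/

variable {V} in
/-- The algebra `[A, B]` of homomorphisms, with pointwise operations. -/
def ihomAlg (A B : V.Alg) : V.Alg where
  carrier := A ⟶ B
  op ω f := Alg.mkHom (fun a => B.op ω fun i => f i a) fun τ x => by
    simp only [Alg.map_op]
    exact op_op B ω τ fun i j => f i (x j)
  sat {k s t} h f := by
    have key : ∀ (r : Term V.Op (Fin k)) (a : A),
        (show A ⟶ B from r.eval (M := A ⟶ B) (fun ω f => Alg.mkHom (fun a => B.op ω fun i => f i a)
          fun τ x => by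
            simp only [Alg.map_op]
            exact op_op B ω τ fun i j => f i (x j)) f) a = r.eval B.op fun i => f i a := by
      intro r a
      induction r with
      | var i => rfl
      | app ω s ih =>
        refine Eq.trans ?_ (congrArg (B.op ω) (funext fun i => ih i))
        rfl
    exact Alg.hom_ext fun a => by
      refine (key s a).trans (Eq.trans ?_ (key t a).symm)
      exact B.sat h _

/-- The enriched hom functor `(A, B) ↦ [A, B]`. -/
def ihomFunctor : V.Algᵒᵖ ⥤ V.Alg ⥤ V.Alg where
  obj A :=
    { obj B := ihomAlg A.unop B
      map {B B'} g := Alg.mkHom (fun f : A.unop ⟶ B => f ≫ g) fun ω f =>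
        Alg.hom_ext fun a => Alg.map_op g ω _
      map_id B := rfl
      map_comp g h := rfl }
  map {A A'} p :=
    { app B := Alg.mkHom (fun f : A.unop ⟶ B => p.unop ≫ f) fun ω f => rfl
      naturality B B' g := rfl }
  map_id A := rfl
  map_comp p q := rfl

/-! #### The algebra objects given by the lifted operations -/

/-- The functor that regards an algebra `A` as an algebra object in the variety, with the
operations `A ^ n ⟶ A` of `A`, which are homomorphisms. -/
def selfObj : V.Alg ⥤ V.ModelObj V.Alg where
  obj A :=
    { X := A
      op {n} ω := Alg.mkHom (fun x => A.op ω fun i => Pi.π (fun _ : Fin n => A) i x) fun τ x => by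
        simp only [Alg.map_op]
        exact op_op A ω τ fun i j => Pi.π (fun _ : Fin n => A) i (x j)
      sat {k s t} h := by
        have key : ∀ (r : Term V.Op (Fin k)) (x : (∏ᶜ fun _ : Fin k => A : V.Alg)),
            evalMor (V := V) (fun {n} ω => Alg.mkHom
              (fun x => A.op ω fun i => Pi.π (fun _ : Fin n => A) i x) fun τ x => by
                simp only [Alg.map_op]
                exact op_op A ω τ fun i j => Pi.π (fun _ : Fin n => A) i (x j)) r x =
              r.eval A.op fun i => Pi.π (fun _ : Fin k => A) i x := by
          intro r x
          induction r with
          | var i => rfl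
          | app ω s ih =>
            simp only [evalMor, Term.eval, Alg.comp_apply, Alg.mkHom_apply, ← ih]
            congr 1
            funext i
            rw [← Alg.comp_apply, Pi.lift_π]
        exact Alg.hom_ext fun x => by
          rw [key, key]
          exact A.sat h _ }
  map {A B} f := ModelObj.Hom.mk f fun {n} ω => Alg.hom_ext fun x => by
    refine (Alg.map_op f ω _).trans ?_
    refine congrArg (B.op ω) (funext fun i => ?_)
    change (Pi.π (fun _ : Fin n => A) i ≫ f) x =
      (Pi.lift (fun i => Pi.π (fun _ : Fin n => A) i ≫ f) ≫ Pi.π (fun _ : Fin n => B) i) x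
    rw [Pi.lift_π]
  map_id A := rfl
  map_comp f g := rfl

/-! #### The enrichment of co-algebras -/

section

variable {V}

/-- The pointwise operation on homomorphisms. -/
abbrev pointwise {A B : V.Alg} {n : ℕ} (ω : V.Op n) (f : Fin n → (A ⟶ B)) : A ⟶ B :=
  (ihomAlg A B).op ω f

theorem pointwise_apply {A B : V.Alg} {n : ℕ} (ω : V.Op n) (f : Fin n → (A ⟶ B)) (a : A) :
    pointwise ω f a = B.op ω fun i => f i a := rfl

theorem pointwise_comm {Y Z : V.CoAlg V.Alg} {n : ℕ} (ω : V.Op n) (f : Fin n → (Y ⟶ Z)) {m : ℕ}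
    (τ : V.Op m) :
    pointwise ω (fun i => CoAlg.Hom.hom (f i)) ≫ Z.coop τ =
      Y.coop τ ≫ Limits.Sigma.desc fun j => pointwise ω (fun i => CoAlg.Hom.hom (f i)) ≫
        Limits.Sigma.ι (fun _ : Fin m => Z.X) j := by
  have h : (Limits.Sigma.desc fun j => pointwise ω (fun i => CoAlg.Hom.hom (f i)) ≫
      Limits.Sigma.ι (fun _ : Fin m => Z.X) j) = pointwise ω fun i =>
        Limits.Sigma.desc fun j => CoAlg.Hom.hom (f i) ≫
          Limits.Sigma.ι (fun _ : Fin m => Z.X) j := by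
    refine Limits.Sigma.hom_ext _ _ fun j => Alg.hom_ext fun y => ?_
    rw [Limits.Sigma.ι_desc, Alg.comp_apply, Alg.comp_apply, pointwise_apply, pointwise_apply,
      Alg.map_op]
    congr 1
    funext i
    rw [← Alg.comp_apply (Limits.Sigma.ι _ j), Limits.Sigma.ι_desc, Alg.comp_apply]
  rw [h]
  refine Alg.hom_ext fun y => ?_
  rw [Alg.comp_apply, Alg.comp_apply, pointwise_apply, pointwise_apply, Alg.map_op]
  congr 1
  funext i
  rw [← Alg.comp_apply, CoAlg.Hom.comm, Alg.comp_apply]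

/-- The algebra of morphisms between two co-algebras, with pointwise operations: a subalgebra of
the enriched hom of the underlying algebras. -/
def coIhomAlg (Y Z : V.CoAlg V.Alg) : V.Alg where
  carrier := Y ⟶ Z
  op ω f := CoAlg.Hom.mk (pointwise ω fun i => CoAlg.Hom.hom (f i)) fun τ => pointwise_comm ω f τ
  sat {k s t} h f := by
    have key : ∀ r : Term V.Op (Fin k),
        CoAlg.Hom.hom (r.eval (M := Y ⟶ Z) (fun ω f => CoAlg.Hom.mk
          (pointwise ω fun i => CoAlg.Hom.hom (f i)) fun τ => pointwise_comm ω f τ) f) =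
        r.eval (ihomAlg Y.X Z.X).op fun i => CoAlg.Hom.hom (f i) := by
      intro r
      induction r with
      | var i => rfl
      | app ω s ih => exact congrArg ((ihomAlg Y.X Z.X).op ω) (funext fun i => ih i)
    apply CoAlg.hom_ext
    rw [key, key]
    exact (ihomAlg Y.X Z.X).sat h _

end

/-- The enriched hom functor of the category of co-algebras. -/
def coIhomFunctor : (V.CoAlg V.Alg)ᵒᵖ ⥤ V.CoAlg V.Alg ⥤ V.Alg where
  obj Y :=
    { obj Z := coIhomAlg Y.unop Z
      map {Z Z'} g := Alg.mkHom (fun f : Y.unop ⟶ Z => f ≫ g) fun ω f =>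
        CoAlg.hom_ext (Alg.hom_ext fun y => Alg.map_op (CoAlg.Hom.hom g) ω _)
      map_id Z := rfl
      map_comp g h := rfl }
  map {Y Y'} p :=
    { app Z := Alg.mkHom (fun f : Y.unop ⟶ Z => p.unop ≫ f) fun ω f => rfl
      naturality Z Z' g := rfl }
  map_id Y := rfl
  map_comp p q := rfl

/-! #### The closed symmetric monoidal structure -/

section Tensor

variable {V}

/-- The relations that make `(a, b) ↦ a ⊗ b` a homomorphism in each variable. -/
inductive TensorRel (A B : V.Alg) : Term V.Op (A × B) → Term V.Op (A × B) → Prop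
  | left {n : ℕ} (ω : V.Op n) (a : Fin n → A) (b : B) :
      TensorRel A B (Term.app ω fun i => Term.var (a i, b)) (Term.var (A.op ω a, b))
  | right (a : A) {n : ℕ} (ω : V.Op n) (b : Fin n → B) :
      TensorRel A B (Term.app ω fun i => Term.var (a, b i)) (Term.var (a, B.op ω b))

/-- The tensor product of algebras, which represents the functions `A × B → X` that are
homomorphisms in each variable. -/
def tensorAlg (A B : V.Alg) : V.Alg := pres (TensorRel A B)

/-- The element `a ⊗ b`. -/
def tmul {A B : V.Alg} (a : A) (b : B) : tensorAlg A B := pres.of (TensorRel A B) (a, b)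

/-- The homomorphism `a ⊗ -`. -/
def tmulLeft {A B : V.Alg} (a : A) : B ⟶ tensorAlg A B :=
  Alg.mkHom (fun b => tmul a b) fun ω b => (pres.rel _ (TensorRel.right a ω b)).symm

/-- The homomorphism `- ⊗ b`. -/
def tmulRight {A B : V.Alg} (b : B) : A ⟶ tensorAlg A B :=
  Alg.mkHom (fun a => tmul a b) fun ω a => (pres.rel _ (TensorRel.left ω a b)).symm

theorem tensor_ext {A B X : V.Alg} {f g : tensorAlg A B ⟶ X}
    (h : ∀ a b, f (tmul a b) = g (tmul a b)) : f = g :=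
  pres.hom_ext _ fun p => h p.1 p.2

theorem tensor_ext₃ {A B C X : V.Alg} {f g : tensorAlg (tensorAlg A B) C ⟶ X}
    (h : ∀ a b c, f (tmul (tmul a b) c) = g (tmul (tmul a b) c)) : f = g :=
  tensor_ext fun t c => congrArg (fun k : tensorAlg A B ⟶ X => k t)
    (tensor_ext (f := tmulRight c ≫ f) (g := tmulRight c ≫ g) fun a b => h a b c)

theorem tensor_ext₃' {A B C X : V.Alg} {f g : tensorAlg A (tensorAlg B C) ⟶ X}
    (h : ∀ a b c, f (tmul a (tmul b c)) = g (tmul a (tmul b c))) : f = g :=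
  tensor_ext fun a t => congrArg (fun k : tensorAlg B C ⟶ X => k t)
    (tensor_ext (f := tmulLeft a ≫ f) (g := tmulLeft a ≫ g) fun b c => h a b c)

theorem tensor_ext₄ {A B C D X : V.Alg} {f g : tensorAlg (tensorAlg (tensorAlg A B) C) D ⟶ X}
    (h : ∀ a b c d, f (tmul (tmul (tmul a b) c) d) = g (tmul (tmul (tmul a b) c) d)) : f = g :=
  tensor_ext fun t d => congrArg (fun k : tensorAlg (tensorAlg A B) C ⟶ X => k t)
    (tensor_ext₃ (f := tmulRight d ≫ f) (g := tmulRight d ≫ g) fun a b c => h a b c d)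

/-- The adjunction `Hom(A ⊗ B, X) ≃ Hom(A, [B, X])`. -/
def tensorEquiv (A B X : V.Alg) : (tensorAlg A B ⟶ X) ≃ (A ⟶ ihomAlg B X) where
  toFun f := Alg.mkHom (fun a => tmulLeft a ≫ f) fun ω a => Alg.hom_ext fun b =>
    Alg.map_op (tmulRight b ≫ f) ω a
  invFun φ := pres.lift _ (fun p => (show B ⟶ X from φ p.1) p.2) (by
    rintro _ _ (⟨ω, a, b⟩ | ⟨a, ω, b⟩)
    · exact (congrArg (fun f : B ⟶ X => f b) (Alg.map_op φ ω a)).symm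
    · exact (Alg.map_op (show B ⟶ X from φ a) ω b).symm)
  left_inv f := tensor_ext fun a b => rfl
  right_inv φ := rfl

/-- The homomorphism `a ⊗ b ↦ f a b`. -/
def tensorLift {A B X : V.Alg} (f : A → (B ⟶ X))
    (hf : ∀ (b : B) {n : ℕ} (ω : V.Op n) (a : Fin n → A),
      f (A.op ω a) b = X.op ω fun i => f (a i) b) : tensorAlg A B ⟶ X :=
  (tensorEquiv A B X).symm (Alg.mkHom f fun ω a => Alg.hom_ext fun b => hf b ω a)

@[simp] theorem tensorLift_tmul {A B X : V.Alg} (f : A → (B ⟶ X))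
    (hf : ∀ (b : B) {n : ℕ} (ω : V.Op n) (a : Fin n → A),
      f (A.op ω a) b = X.op ω fun i => f (a i) b) (a : A) (b : B) :
    tensorLift f hf (tmul a b) = f a b := rfl

/-- The homomorphism `f ⊗ g`. -/
def tensorMap {A A' B B' : V.Alg} (f : A ⟶ A') (g : B ⟶ B') : tensorAlg A B ⟶ tensorAlg A' B' :=
  tensorLift (fun a => g ≫ tmulLeft (f a)) fun b _ ω a =>
    Alg.map_op (f ≫ tmulRight (g b)) ω a

@[simp] theorem tensorMap_tmul {A A' B B' : V.Alg} (f : A ⟶ A') (g : B ⟶ B') (a : A) (b : B) :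
    tensorMap f g (tmul a b) = tmul (f a) (g b) := rfl

/-- The associator `(a ⊗ b) ⊗ c ↦ a ⊗ (b ⊗ c)`. -/
def tensorAssoc (A B C : V.Alg) :
    tensorAlg (tensorAlg A B) C ≅ tensorAlg A (tensorAlg B C) where
  hom := (tensorEquiv _ _ _).symm ((tensorEquiv _ _ _).symm
    (Alg.mkHom (fun a => (tensorEquiv B C _ (tmulLeft a) : B ⟶ ihomAlg C _)) fun ω a =>
      Alg.hom_ext fun b => Alg.hom_ext fun c => Alg.map_op (tmulRight (tmul b c)) ω a))
  inv := tensorLift (fun a => tensorMap (tmulLeft a) (𝟙 C)) fun t n ω a => by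
    have h : ∀ t, tensorMap (tmulLeft ((A.op ω a))) (𝟙 C) t =
        pointwise ω (fun i => tensorMap (tmulLeft (B := B) (a i)) (𝟙 C)) t := fun t =>
      congrArg (fun k : tensorAlg B C ⟶ _ => k t) (tensor_ext fun b c =>
        Alg.map_op (tmulRight b ≫ tmulRight (A := tensorAlg A B) c) ω a)
    exact h t
  hom_inv_id := tensor_ext₃ fun a b c => rfl
  inv_hom_id := tensor_ext₃' fun a b c => rfl

/-- The left unitor. -/
def tensorLeftUnitor (A : V.Alg) : tensorAlg (V.free.obj PUnit) A ≅ A where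
  hom := (tensorEquiv _ _ _).symm (freeAlg.lift fun _ => (𝟙 A : A ⟶ A))
  inv := tmulLeft (freeAlg.of PUnit.unit)
  hom_inv_id := tensor_ext fun t a => congrArg (fun k : V.freeAlg PUnit ⟶ _ => k t)
    (freeAlg.hom_ext
      (f := tmulRight a ≫ (tensorEquiv _ _ _).symm (freeAlg.lift fun _ => (𝟙 A : A ⟶ A)) ≫
        tmulLeft (freeAlg.of PUnit.unit))
      (g := tmulRight a) fun _ => rfl)
  inv_hom_id := rfl

/-- The braiding `a ⊗ b ↦ b ⊗ a`. -/
def tensorBraiding (A B : V.Alg) : tensorAlg A B ≅ tensorAlg B A where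
  hom := tensorLift (fun a => tmulRight a) fun b _ ω a => Alg.map_op (tmulLeft b) ω a
  inv := tensorLift (fun b => tmulRight b) fun a _ ω b => Alg.map_op (tmulLeft a) ω b
  hom_inv_id := tensor_ext fun a b => rfl
  inv_hom_id := tensor_ext fun a b => rfl

/-- Linton's monoidal structure on a commutative variety: the tensor product represents functions
of two variables that are homomorphisms in each variable, and the unit is the free algebra on one
generator. -/
instance : MonoidalCategory V.Alg where
  tensorObj := tensorAlg
  whiskerLeft A _ _ g := tensorMap (𝟙 A) g
  whiskerRight f B := tensorMap f (𝟙 B)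
  tensorHom := tensorMap
  tensorUnit := V.free.obj PUnit
  associator := tensorAssoc
  leftUnitor := tensorLeftUnitor
  rightUnitor A := tensorBraiding A _ ≪≫ tensorLeftUnitor A
  tensorHom_def f g := tensor_ext fun a b => rfl
  id_tensorHom_id A B := tensor_ext fun a b => rfl
  tensorHom_comp_tensorHom f g f' g' := tensor_ext fun a b => rfl
  whiskerLeft_id A B := tensor_ext fun a b => rfl
  id_whiskerRight A B := tensor_ext fun a b => rfl
  associator_naturality f g h := tensor_ext₃ fun a b c => rfl
  leftUnitor_naturality {A B} f := by
    rw [← Iso.inv_comp_eq, ← Category.assoc, ← Iso.eq_comp_inv]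
    rfl
  rightUnitor_naturality {A B} f := by
    rw [← Iso.inv_comp_eq, ← Category.assoc, ← Iso.eq_comp_inv]
    rfl
  pentagon A B C D := tensor_ext₄ fun a b c d => rfl
  triangle A B := tensor_ext fun s b => congrArg (fun k : tensorAlg A (V.freeAlg PUnit) ⟶ _ => k s)
    (tensor_ext
      (f := tmulRight b ≫ (tensorAssoc _ _ _).hom ≫ tensorMap (𝟙 A) (tensorLeftUnitor B).hom)
      (g := tmulRight b ≫ tensorMap (tensorBraiding A _ ≪≫ tensorLeftUnitor A).hom (𝟙 B))
      fun a t => congrArg (fun k : V.freeAlg PUnit ⟶ _ => k t)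
        (freeAlg.hom_ext
          (f := tmulLeft a ≫ tmulRight b ≫ (tensorAssoc _ _ _).hom ≫
            tensorMap (𝟙 A) (tensorLeftUnitor B).hom)
          (g := tmulLeft a ≫ tmulRight b ≫
            tensorMap (tensorBraiding A _ ≪≫ tensorLeftUnitor A).hom (𝟙 B))
          fun _ => rfl))

/-- Linton's monoidal structure is symmetric. -/
instance : SymmetricCategory V.Alg where
  braiding := tensorBraiding
  braiding_naturality_right A _ _ g := tensor_ext fun a b => rfl
  braiding_naturality_left f C := tensor_ext fun a b => rfl
  hexagon_forward A B C := tensor_ext₃ fun a b c => rfl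
  hexagon_reverse A B C := tensor_ext₃' fun a b c => rfl
  symmetry A B := tensor_ext fun a b => rfl

/-- Linton's monoidal structure is closed, with internal hom `[A, -]`. -/
instance : MonoidalClosed V.Alg where
  closed A :=
    { rightAdj := (ihomFunctor V).obj (op A)
      adj := Adjunction.mkOfHomEquiv
        { homEquiv X Y :=
            { toFun f := Alg.mkHom (fun x => (show A ⟶ Y from tmulRight x ≫ f)) fun ω x =>
                Alg.hom_ext fun a => Alg.map_op (tmulLeft a ≫ (show tensorAlg A X ⟶ Y from f)) ω x
              invFun φ := (tensorBraiding A X).hom ≫ (tensorEquiv X A Y).symm φ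
              left_inv f := tensor_ext fun a x => rfl
              right_inv φ := rfl }
          homEquiv_naturality_left_symm f g := tensor_ext fun a x => rfl
          homEquiv_naturality_right f g := rfl } }

end Tensor

end Commutative
end Variety
end TallWraith
end

open MonoidalCategory

noncomputable section

namespace TallWraith
namespace Variety

section Commutative

variable (V : Variety.{u}) [V.IsCommutative]

/-! ### The canonical co-algebra on an algebra -/

section CanonicalCoAlg

variable {V}

/-! In a commutative variety the homomorphisms $A\to B$ form an algebra $[A,B]$ under pointwise
operations. Inside $[A, A\sqcup\dots\sqcup A]$ one can therefore apply $\omega$ to the $n$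
coprojections, and the result is a homomorphism: this is the co-operation of $C(A)$, with $A$ itself
as underlying algebra. Composing it with the map of components $f_1,\dots,f_n$ gives the pointwise
$\omega(f_1,\dots,f_n)$ (`canonicalCoop_desc`). So $\mathrm{Hom}(C(A),B)$ is $[A,B]$ with the same
underlying set, and everything else follows from this computation.

The right adjoint takes the primitive elements of $Y$, those $y$ with
$y\mapsto\omega(\iota_1y,\dots,\iota_ny)$ under every co-operation. They form a subalgebra, being
cut out by equations between homomorphisms. Every element of $C(A)$ is primitive and morphisms
preserve primitivity (`IsPrimitive.map`), so a morphism $C(A)\to Y$ is the same as a homomorphism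
from $A$ into the primitive elements. All operations on morphisms are pointwise, which makes the
adjunction enriched.

On a free algebra the canonical co-operations and those of $\hat F$ agree on generators, hence
everywhere.

For monoidality, currying gives $[A\otimes B,X]\cong[A,[B,X]]$, that is, $\mathrm{Hom}(C(A\otimes
B),X)\cong\mathrm{Hom}(C(A),\mathrm{Hom}(C(B),X))$. Thus $A\mapsto\mathrm{Hom}(C(A),-)$ is strong
monoidal into representable functors under composition (`canonicalToCovRepCoreMonoidal`). The
Tall–Wraith structure is transported from there, so $C$ is strong monoidal too. -/

/-- The canonical co-operation `a ↦ ω (ι₁ a, …, ιₙ a)` on an algebra. -/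
def canonicalCoop (A : V.Alg) {n : ℕ} (ω : V.Op n) : A ⟶ ∐ fun _ : Fin n => A :=
  pointwise ω fun i => Limits.Sigma.ι (fun _ : Fin n => A) i

theorem pointwise_comp {A B D : V.Alg} {n : ℕ} (ω : V.Op n) (f : Fin n → (A ⟶ B)) (g : B ⟶ D) :
    pointwise ω f ≫ g = pointwise ω fun i => f i ≫ g :=
  Alg.hom_ext fun _ => Alg.map_op g ω _

theorem comp_pointwise {A B D : V.Alg} {n : ℕ} (ω : V.Op n) (f : Fin n → (B ⟶ D)) (g : A ⟶ B) :
    g ≫ pointwise ω f = pointwise ω fun i => g ≫ f i := rfl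

/-- Postcomposition with `Limits.Sigma.desc f` preserves pointwise operations and carries the
coprojections to the `f i`. Consequently the operations on `Hom(C A, B)` are the pointwise ones. -/
theorem canonicalCoop_desc {A B : V.Alg} {n : ℕ} (ω : V.Op n) (f : Fin n → (A ⟶ B)) :
    canonicalCoop A ω ≫ Limits.Sigma.desc f = pointwise ω f := by
  rw [canonicalCoop, pointwise_comp]
  congr 1
  funext i
  exact Limits.Sigma.ι_desc _ _

/-- Reduces the co-identities to the identities of the single algebra $[A, A\sqcup\dots\sqcup A]$,
evaluated at the coprojections. The induction step is `canonicalCoop_desc`. -/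
theorem coevalMor_canonicalCoop {A : V.Alg} {k : ℕ} (t : Term V.Op (Fin k)) :
    coevalMor (V := V) (fun ω => canonicalCoop A ω) t =
      t.eval (ihomAlg A (∐ fun _ : Fin k => A)).op fun i =>
        Limits.Sigma.ι (fun _ : Fin k => A) i := by
  induction t with
  | var i => rfl
  | app ω s ih =>
    simp only [coevalMor, Term.eval, ih]
    exact canonicalCoop_desc ω _

/-- An algebra of a commutative variety as a co-algebra, with the canonical co-operations. -/
def canonicalCoAlg (A : V.Alg) : V.CoAlg V.Alg where
  X := A
  coop ω := canonicalCoop A ω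
  sat {k s t} h := by
    rw [coevalMor_canonicalCoop, coevalMor_canonicalCoop]
    exact (ihomAlg A (∐ fun _ : Fin k => A)).sat h _

end CanonicalCoAlg

/-! ### The canonical functor and the functors it represents -/

/-- The functor that equips an algebra with its canonical co-operations. -/
def canonical : V.Alg ⥤ V.CoAlg V.Alg where
  obj A := canonicalCoAlg A
  map {A B} f := CoAlg.Hom.mk f fun {n} ω =>
    -- Both composites are the pointwise $\omega$ of the maps $f$ followed by $\iota_i$, so every
    -- homomorphism is a co-algebra morphism.
    (comp_pointwise ω _ f).trans (canonicalCoop_desc ω fun i =>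
      f ≫ Limits.Sigma.ι (fun _ : Fin n => B) i).symm
  map_id A := rfl
  map_comp f g := rfl

/-- The functor represented by the canonical co-algebra is the internal hom. -/
def canonicalHomIso : (canonical V).op ⋙ CoAlg.homFunctor V V.Alg ≅ V.ihomFunctor :=
  NatIso.ofComponents
    (fun A => NatIso.ofComponents
      -- The two algebras share their carrier; only the descriptions of the operations differ.
      (fun B => Alg.isoMk (Equiv.refl (A.unop ⟶ B)) fun ω f => canonicalCoop_desc ω f)
      (fun g => rfl))
    (fun p => rfl)

/-- The internal hom is the algebra of morphisms into the algebra object `V.selfObj`. -/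
def ihomIsoSelfObj : V.ihomFunctor ≅ ModelObj.homFunctor V V.Alg ⋙
    (Functor.whiskeringLeft V.Alg (V.ModelObj V.Alg) V.Alg).obj V.selfObj :=
  NatIso.ofComponents
    (fun A => NatIso.ofComponents
      (fun B => Alg.isoMk (Equiv.refl (A.unop ⟶ B)) fun {n} ω f =>
        -- The operation of `V.selfObj` reads off the coordinates of `Pi.lift f`, and the `i`-th one
        -- at `a` is `f i a`.
        Alg.hom_ext (A := A.unop) (B := B) fun a =>
          congrArg (B.op ω) (funext fun i =>
            congrArg (fun k : A.unop ⟶ B => k a)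
              (Pi.lift_π (f := fun _ : Fin n => B) f i).symm))
      (fun g => rfl))
    (fun p => rfl)

/-! ### Factorization of the lifted free functor -/

theorem freeCoAlg_eq_canonicalCoAlg (S : Type u) :
    canonicalCoAlg (V.freeAlg S) = V.freeCoAlg S := by
  -- Both co-operations send a generator $s$ to $\omega(\iota_1s,\dots,\iota_ns)$. Equating them as
  -- functions of arity and symbol lets congruence identify the two structures, whose remaining
  -- field is a proof.
  have h : @canonicalCoop V _ (V.freeAlg S) = @freeCoop V S := by
    funext n ω
    exact freeAlg.hom_ext fun s => rfl
  unfold canonicalCoAlg freeCoAlg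
  congr 1

/-- Needed because the factorization through `V.free` is an equality of functors, whose action on
morphisms is compared up to `eqToHom`. -/
theorem CoAlg.eqToHom_hom {D : Type w} [Category.{u} D] [HasFiniteCoproducts D] {V : Variety.{u}}
    {Y Z : V.CoAlg D} (h : Y = Z) :
    CoAlg.Hom.hom (eqToHom h) = eqToHom (congrArg CoAlg.X h) := by
  subst h
  rfl

theorem free_comp_canonical : V.free ⋙ canonical V = V.freeHat :=
  CategoryTheory.Functor.ext (fun S => freeCoAlg_eq_canonicalCoAlg V S) fun S T f => by
    apply CoAlg.hom_ext
    -- The two co-algebras have definitionally the same underlying algebra, so the transport is the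
    -- identity there.
    have h : ∀ S, CoAlg.Hom.hom (eqToHom (freeCoAlg_eq_canonicalCoAlg V S)) = 𝟙 (V.freeAlg S) :=
      fun S => CoAlg.eqToHom_hom _
    have h' : ∀ S, CoAlg.Hom.hom (eqToHom (freeCoAlg_eq_canonicalCoAlg V S).symm) =
      𝟙 (V.freeAlg S) := fun S => CoAlg.eqToHom_hom _
    exact (congrArg₂ (fun p q => p ≫ V.free.map f ≫ q) (h S) (h' T)).symm

/-! ### The right adjoint of the canonical functor -/

section Primitive

variable {V}

/-- An element of a co-algebra is primitive if every co-operation acts on it canonically. -/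
def IsPrimitive (Y : V.CoAlg V.Alg) (y : Y.X) : Prop :=
  ∀ {n : ℕ} (ω : V.Op n), Y.coop ω y = canonicalCoop Y.X ω y

/-- Both the given and the canonical co-operation are homomorphisms, and the locus where two
homomorphisms agree is closed under operations. Commutativity enters in making the canonical one a
homomorphism. -/
theorem IsPrimitive.op {Y : V.CoAlg V.Alg} {m : ℕ} (τ : V.Op m) {y : Fin m → Y.X}
    (hy : ∀ j, IsPrimitive Y (y j)) : IsPrimitive Y (Y.X.op τ y) := fun ω => by
  rw [Alg.map_op, Alg.map_op]
  exact congrArg _ (funext fun j => hy j ω)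

/-- Commutation of `f` with the co-operations moves the question to `Y`, where primitivity gives
$\omega(\iota_1y,\dots,\iota_ny)$; the induced map of coproducts turns this into
$\omega(\iota_1f(y),\dots,\iota_nf(y))$. -/
theorem IsPrimitive.map {Y Z : V.CoAlg V.Alg} (f : Y ⟶ Z) {y : Y.X} (hy : IsPrimitive Y y) :
    IsPrimitive Z (CoAlg.Hom.hom f y) := fun {n} ω => by
  rw [← Alg.comp_apply, CoAlg.Hom.comm, Alg.comp_apply, hy, ← Alg.comp_apply, canonicalCoop_desc]
  rfl

/-- In a canonical co-algebra every element is primitive by definition, and morphisms preserve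
primitivity. -/
theorem isPrimitive_hom {A : V.Alg} {Y : V.CoAlg V.Alg} (f : (canonical V).obj A ⟶ Y) (a : A) :
    IsPrimitive Y ((CoAlg.Hom.hom f : A ⟶ Y.X) a) :=
  IsPrimitive.map f (y := (a : ((canonical V).obj A).X)) fun _ => rfl

/-- The subalgebra of primitive elements of a co-algebra. -/
def primitiveAlg (Y : V.CoAlg V.Alg) : V.Alg where
  carrier := { y : Y.X // IsPrimitive Y y }
  op τ y := ⟨Y.X.op τ fun j => (y j).1, IsPrimitive.op τ fun j => (y j).2⟩
  sat {k s t} h y := by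
    have key : ∀ r : Term V.Op (Fin k),
        (r.eval (M := { y : Y.X // IsPrimitive Y y })
          (fun τ y => ⟨Y.X.op τ fun j => (y j).1, IsPrimitive.op τ fun j => (y j).2⟩) y).1 =
          r.eval Y.X.op fun j => (y j).1 := by
      intro r
      induction r with
      | var i => rfl
      | app ω s ih => exact congrArg (Y.X.op ω) (funext ih)
    apply Subtype.ext
    rw [key, key]
    exact Y.X.sat h _

end Primitive

/-- The functor of primitive elements. -/
def primitive : V.CoAlg V.Alg ⥤ V.Alg where
  obj Y := primitiveAlg Y
  map {Y Z} f := Alg.mkHom (A := primitiveAlg Y) (B := primitiveAlg Z)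
    (fun y => ⟨CoAlg.Hom.hom f y.1, IsPrimitive.map f y.2⟩)
    fun ω y => Subtype.ext (Alg.map_op (CoAlg.Hom.hom f) ω _)
  map_id Y := rfl
  map_comp f g := rfl

/-- Morphisms from a canonical co-algebra are homomorphisms to the primitive elements. -/
def canonicalHomEquiv (A : V.Alg) (Y : V.CoAlg V.Alg) :
    ((canonical V).obj A ⟶ Y) ≃ (A ⟶ (primitive V).obj Y) where
  toFun f := Alg.mkHom (A := A) (B := primitiveAlg Y)
    (fun a => ⟨(CoAlg.Hom.hom f : A ⟶ Y.X) a, isPrimitive_hom f a⟩)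
    fun ω a => Subtype.ext (Alg.map_op (CoAlg.Hom.hom f : A ⟶ Y.X) ω a)
  invFun g := CoAlg.Hom.mk
    (Alg.mkHom (A := A) (B := Y.X) (fun a => (g a).1) fun ω a =>
      congrArg Subtype.val (Alg.map_op g ω a))
    fun {n} ω => by
      -- Primitivity of `g a` evaluates one side; `canonicalCoop_desc` evaluates the other to the
      -- same element.
      refine Alg.hom_ext fun a => ((g a).2 ω).trans ?_
      exact (congrArg (fun k : A ⟶ _ => k a) (canonicalCoop_desc ω fun i =>
        Alg.mkHom (A := A) (B := Y.X) (fun a => (g a).1) (fun ω a =>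
          congrArg Subtype.val (Alg.map_op g ω a)) ≫
            Limits.Sigma.ι (fun _ : Fin n => Y.X) i)).symm
  left_inv f := rfl
  right_inv g := rfl

/-- The canonical functor is left adjoint to the functor of primitive elements. -/
def canonicalAdj : canonical V ⊣ primitive V :=
  Adjunction.mkOfHomEquiv
    { homEquiv := canonicalHomEquiv V
      homEquiv_naturality_left_symm f g := rfl
      homEquiv_naturality_right f g := rfl }

/-- The adjunction between `canonical` and `primitive` is enriched. -/
def canonicalEnrichedIso : (canonical V).op ⋙ V.coIhomFunctor ≅
    V.ihomFunctor ⋙ (Functor.whiskeringLeft (V.CoAlg V.Alg) V.Alg V.Alg).obj (primitive V) :=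
  NatIso.ofComponents
    (fun A => NatIso.ofComponents
      (fun Y => Alg.isoMk (A := coIhomAlg ((canonical V).obj A.unop) Y)
        (B := ihomAlg A.unop ((primitive V).obj Y))
        -- On both sides the operations are computed pointwise in `Y.X`.
        (canonicalHomEquiv V A.unop Y) fun ω f => rfl)
      (fun g => rfl))
    (fun p => rfl)

/-! ### The canonical functor is strong monoidal -/

attribute [local instance] compositionMonoidal

/-- `Hom(C(A ⊗ B), X) ≅ Hom(C A, Hom(C B, X))`. -/
def tensorHomIso (A B : V.Alg) :
    CoAlg.homFrom (canonicalCoAlg (tensorAlg A B)) ≅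
      CoAlg.homFrom (canonicalCoAlg B) ⋙ CoAlg.homFrom (canonicalCoAlg A) :=
  NatIso.ofComponents
    (fun X => Alg.isoMk
      (A := CoAlg.homAlg (canonicalCoAlg (tensorAlg A B)) X)
      (B := CoAlg.homAlg (canonicalCoAlg A) (CoAlg.homAlg (canonicalCoAlg B) X))
      ((tensorEquiv A B X).trans (Iso.homToEquiv (Z := A)
        ((((canonicalHomIso V).app (op B)).app X).symm :
          ihomAlg B X ≅ CoAlg.homAlg (canonicalCoAlg B) X)))
      fun {n} ω f => Alg.hom_ext (A := A) (B := CoAlg.homAlg (canonicalCoAlg B) X) fun a =>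
        Alg.hom_ext (A := B) (B := X) fun b => by
          let g : Fin n → (A ⟶ CoAlg.homAlg (canonicalCoAlg B) X) := fun i =>
            tensorEquiv A B X (f i) ≫ ((canonicalHomIso V).app (op B)).inv.app X
          -- Compare values at $a\otimes b$. The operation is pointwise on $A\otimes B$ (`h₁`); on
          -- the curried side it is pointwise first in $a$ (`h₂`), then in $b$ (`h₃`).
          have h₁ := congrArg (fun k : tensorAlg A B ⟶ X => k (tmul a b))
            (canonicalCoop_desc (A := tensorAlg A B) ω f)
          have h₂ := congrArg (fun k : A ⟶ CoAlg.homAlg (canonicalCoAlg B) X =>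
            (show B ⟶ X from k a) b) (canonicalCoop_desc ω g)
          have h₃ := congrArg (fun k : B ⟶ X => k b) (canonicalCoop_desc ω fun i => g i a)
          exact h₁.trans (h₂.trans h₃).symm)
    (fun g => rfl)

/-- `Hom(C(F {*}), -)` is the identity functor. -/
def unitHomIso : CoAlg.homFrom (canonicalCoAlg (V.free.obj PUnit)) ≅ 𝟭 V.Alg :=
  NatIso.ofComponents
    (fun X => Alg.isoMk (A := CoAlg.homAlg (canonicalCoAlg (V.freeAlg PUnit)) X) (B := X)
      ⟨fun f : V.freeAlg PUnit ⟶ X => f (freeAlg.of PUnit.unit), fun x => freeAlg.lift fun _ => x,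
        fun f => freeAlg.hom_ext fun _ => rfl, fun x => rfl⟩
      fun {n} ω f => congrArg (fun k : V.freeAlg PUnit ⟶ X => k (freeAlg.of PUnit.unit))
        (canonicalCoop_desc ω f))
    (fun g => rfl)

/-- The functor `A ↦ Hom(C A, -)` to representable functors is strong monoidal. -/
def canonicalToCovRepCoreMonoidal : (canonical V ⋙ toCovRep V).CoreMonoidal where
  εIso := (V.representable.isoMk (unitHomIso V)).op
  μIso A B := (V.representable.isoMk (tensorHomIso V A B)).op
  μIso_hom_natural_left f X := by
    apply Quiver.Hom.unop_inj
    apply ObjectProperty.hom_ext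
    ext X
    rfl
  μIso_hom_natural_right X f := by
    apply Quiver.Hom.unop_inj
    apply ObjectProperty.hom_ext
    ext X
    rfl
  -- In the opposite category the structure maps become currying, so both sides send $f$ to
  -- $a\mapsto b\mapsto d\mapsto f(a\otimes(b\otimes d))$, definitionally. In the unit laws,
  -- evaluating at the free generator returns the original homomorphism.
  associativity A B D := by
    apply Quiver.Hom.unop_inj
    apply ObjectProperty.hom_ext
    ext X
    rfl
  left_unitality A := by
    apply Quiver.Hom.unop_inj
    apply ObjectProperty.hom_ext
    ext X
    rfl
  right_unitality A := by
    apply Quiver.Hom.unop_inj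
    apply ObjectProperty.hom_ext
    ext X
    rfl

/-! ### Transfer of monoidality to co-algebras -/

instance : (canonical V ⋙ toCovRep V).Monoidal := (canonicalToCovRepCoreMonoidal V).toMonoidal

/-- The Tall–Wraith structure is by definition transported along this inverse. -/
instance : (toCovRep V).asEquivalence.inverse.Monoidal :=
  inferInstanceAs (Monoidal.equivalenceTransported (toCovRep V).asEquivalence.symm).functor.Monoidal

/-- Monoidality can be tested after composing with a monoidal equivalence. -/
instance : (canonical V).Monoidal :=
  (toCovRep V).asEquivalence.monoidalOfPostcompFunctor (canonical V)
    (F' := canonical V ⋙ toCovRep V) (Iso.refl _)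

end Commutative
end Variety
end TallWraith
end

theorem mainTheorem6 (V : TallWraith.Variety.{u}) [V.IsCommutative] :
    ∃ C : V.Alg ⥤ V.CoAlg V.Alg,
      -- natural isomorphism of algebras `Hom(C A, B) ≅ [A, B]`
      Nonempty (C.op ⋙ TallWraith.Variety.CoAlg.homFunctor V V.Alg ≅ V.ihomFunctor) ∧
      -- `C` is right inverse to the forgetful functor
      C ⋙ TallWraith.Variety.CoAlg.forget V V.Alg = 𝟭 V.Alg ∧
      -- `C` is a left adjoint, and the adjunction is enriched
      (∃ (R : V.CoAlg V.Alg ⥤ V.Alg) (adj : C ⊣ R)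
        (e : C.op ⋙ V.coIhomFunctor ≅
          V.ihomFunctor ⋙ (Functor.whiskeringLeft (V.CoAlg V.Alg) V.Alg V.Alg).obj R),
        (∀ (A : V.Alg) (Y : V.CoAlg V.Alg) (f : C.obj A ⟶ Y),
          (e.hom.app (op A)).app Y f = adj.homEquiv A Y f) ∧
        (∀ (A B : V.Alg) (n : ℕ) (ω : V.Op n) (f : Fin n → (A ⟶ B)),
          C.map ((TallWraith.Variety.ihomAlg A B).op ω f) =
            (TallWraith.Variety.coIhomAlg (C.obj A) (C.obj B)).op ω fun i => C.map (f i)) ∧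
        (∀ (Y Z : V.CoAlg V.Alg) (n : ℕ) (ω : V.Op n) (f : Fin n → (Y ⟶ Z)),
          R.map ((TallWraith.Variety.coIhomAlg Y Z).op ω f) =
            (TallWraith.Variety.ihomAlg (R.obj Y) (R.obj Z)).op ω fun i => R.map (f i))) ∧
      -- natural isomorphism of algebras between `Hom(C A, B)` and `Hom(A, B)`, the latter with
      -- the structure given by `B` as an algebra object in the variety
      Nonempty (C.op ⋙ TallWraith.Variety.CoAlg.homFunctor V V.Alg ≅
        TallWraith.Variety.ModelObj.homFunctor V V.Alg ⋙
          (Functor.whiskeringLeft V.Alg (V.ModelObj V.Alg) V.Alg).obj V.selfObj) ∧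
      -- the lift of the free functor factors through `C`
      V.free ⋙ C = V.freeHat ∧
      -- `C` is strong monoidal
      Nonempty C.Monoidal :=
  ⟨V.canonical, ⟨V.canonicalHomIso⟩, rfl,
    ⟨V.primitive, V.canonicalAdj, V.canonicalEnrichedIso,
      -- The adjunction and the enriched isomorphism are built from the same bijection
      -- `canonicalHomEquiv`.
      fun _ _ _ => by rw [TallWraith.Variety.canonicalAdj, Adjunction.mkOfHomEquiv_homEquiv]; rfl,
      fun _ _ _ _ _ => rfl, fun _ _ _ _ _ => rfl⟩,
    ⟨V.canonicalHomIso ≪≫ V.ihomIsoSelfObj⟩, V.free_comp_canonical, ⟨inferInstance⟩⟩
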